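/- Let $p$ be a prime number. A $\mathbb{Z}$-system of order $p$ is a pair $(X,(x_n)_{n\in\mathbb{Z}})$ consisting of a group $X$ and a family $(x_n)_{n\in\mathbb{Z}}$ of elements of $X$ such that 1. $X=\langle x_n \mid n\in\mathbb{Z}\rangle$; 2. for all integers $n\le m$, the subgroup $\langle x_k \mid n\le k\le m\rangle$ has order $p^{m-n+1}$; 3. there exists an automorphism $t$ of $X$ such that $t(x_n)=x_{n+2}$ for all $n\in\mathbb{Z}$. Theorem. Let $p$ be a prime and let $(X,(x_n)_{n\in\mathbb{Z}})$ be a $\mathbb{Z}$-system of order $p$. Then $X$ is nilpotent of class at most $2$; that is, $[[X,X],X]=1$. -/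

import Mathlib

/-- `IsZSystem p x` says that the group `X` together with the family `x : ℤ → X`
is a `ℤ`-system of order `p` (used for prime `p`). -/
structure IsZSystem {X : Type*} [Group X] (p : ℕ) (x : ℤ → X) : Prop where
  /-- `X` is generated by the family. -/
  closure_range : Subgroup.closure (Set.range x) = ⊤
  /-- `⟨x_k ∣ n ≤ k ≤ m⟩` has order `p ^ (m - n + 1)`. Here `m - n + 1 ≥ 1`, so `Int.toNat` does not
  truncate; the value is positive for prime `p`, so `Nat.card` forces finiteness. -/
  card_closure : ∀ n m : ℤ, n ≤ m →
    Nat.card (Subgroup.closure (x '' Set.Icc n m)) = p ^ (m - n + 1).toNat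
  /-- There is a shift automorphism. -/
  exists_shift : ∃ t : X ≃* X, ∀ n : ℤ, t (x n) = x (n + 2)

/-! Only a shift by two is available, while the rays `⟨x_k ∣ k ≥ a⟩` lose two cyclic factors under
it. One factor is removed as follows. In a large finite p-group, a subgroup of bounded index
contains nontrivial central elements; hence, for at least one parity of the leading index, some
elements centralize arbitrarily large windows (`isCentralIndex_zero_or_one`). Enlarging the rays by
such elements gives `hull`. Its even-indexed terms have cyclic successive quotients, and commutators
do not notice the enlargement (`commutator_mem_ray_of_mem_hull`).

The hulls from the two ends are opposite filtrations `E`, `F`. Their total intersection `T` is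
central: a commutator of an element of `T` with `x q` lies both in the part of X above `q` and in
the part below `q`, so it is trivial.

The quotient by `T` is abelian by `IsBifiltration.commute_all`. Otherwise let `k` be the least
length `b - a` of a noncommutative `E a ⊓ F b`. Noncommutativity is then carried by `v ∈ E 0 ⊓ F (k
- 1)` and `u ∈ E 1 ⊓ F k`. If `⁅v, u⁆` had a last position in `E`, comparing `u` with its translate
by that amount would force a translate of `v` and `u` to commute. So `⁅v, u⁆` lies in every `E a`
and, by symmetry, in every `F b`; it is therefore trivial, a contradiction. Hence commutators of X
lie in the central subgroup `T`. -/

/-! ### Groups with two opposite filtrations are abelian. -/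

section Bifiltration

open scoped commutatorElement

variable {G : Type*} [Group G]

/-- Two opposite exhaustive filtrations of a group with cyclic quotients, shifted by one step by an
automorphism, which intersect trivially and whose equal-index intersections are commutative. -/
structure IsBifiltration (t : G ≃* G) (E F : ℤ → Subgroup G) : Prop where
  lower_le : ∀ a, E (a + 1) ≤ E a
  le_upper : ∀ b, F (b - 1) ≤ F b
  map_lower : ∀ a g, t g ∈ E (a + 1) ↔ g ∈ E a
  map_upper : ∀ b g, t g ∈ F (b + 1) ↔ g ∈ F b
  lower_cyclic : ∀ a g h, g ∈ E a → h ∈ E a → h ∉ E (a + 1) → ∃ n : ℤ, g * h ^ n ∈ E (a + 1)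
  upper_cyclic : ∀ b g h, g ∈ F b → h ∈ F b → h ∉ F (b - 1) → ∃ n : ℤ, g * h ^ n ∈ F (b - 1)
  lower_comm : ∀ a g h, g ∈ E a → h ∈ E a → ⁅g, h⁆ ∈ E (a + 1)
  upper_comm : ∀ b g h, g ∈ F b → h ∈ F b → ⁅g, h⁆ ∈ F (b - 1)
  commute : ∀ a g h, g ∈ E a → g ∈ F a → h ∈ E a → h ∈ F a → Commute g h
  separated : ∀ g, (∀ a, g ∈ E a) → (∀ b, g ∈ F b) → g = 1
  lower_exhaustive : ∀ g, ∃ a, g ∈ E a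
  upper_exhaustive : ∀ g, ∃ b, g ∈ F b

namespace IsBifiltration

variable {t : G ≃* G} {E F : ℤ → Subgroup G}

theorem reverse (h : IsBifiltration t E F) :
    IsBifiltration t.symm (fun a => F (-a)) (fun b => E (-b)) where
  lower_le a := by
    have := h.le_upper (-a)
    rwa [show -a - 1 = -(a + 1) by ring] at this
  le_upper b := by
    have := h.lower_le (-b)
    rwa [show -b + 1 = -(b - 1) by ring] at this
  map_lower a g := by
    have := h.map_upper (-(a + 1)) (t.symm g)
    rw [show -(a + 1) + 1 = -a by ring, t.apply_symm_apply] at this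
    exact this.symm
  map_upper b g := by
    have := h.map_lower (-(b + 1)) (t.symm g)
    rw [show -(b + 1) + 1 = -b by ring, t.apply_symm_apply] at this
    exact this.symm
  lower_cyclic a g k := by
    have := h.upper_cyclic (-a) g k
    rwa [show -a - 1 = -(a + 1) by ring] at this
  upper_cyclic b g k := by
    have := h.lower_cyclic (-b) g k
    rwa [show -b + 1 = -(b - 1) by ring] at this
  lower_comm a g k := by
    have := h.upper_comm (-a) g k
    rwa [show -a - 1 = -(a + 1) by ring] at this
  upper_comm b g k := by
    have := h.lower_comm (-b) g k
    rwa [show -b + 1 = -(b - 1) by ring] at this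
  commute a g k h1 h2 h3 h4 := h.commute (-a) g k h2 h1 h4 h3
  separated g h1 h2 := h.separated g (fun a => by simpa using h2 (-a)) fun b => by
    simpa using h1 (-b)
  lower_exhaustive g := by
    obtain ⟨b, hb⟩ := h.upper_exhaustive g
    exact ⟨-b, by simpa using hb⟩
  upper_exhaustive g := by
    obtain ⟨b, hb⟩ := h.lower_exhaustive g
    exact ⟨-b, by simpa using hb⟩

theorem lower_anti (h : IsBifiltration t E F) : Antitone E :=
  antitone_int_of_succ_le h.lower_le

theorem upper_mono (h : IsBifiltration t E F) : Monotone F :=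
  monotone_int_of_le_succ fun b => by simpa using h.le_upper (b + 1)

theorem pow_mem_lower (h : IsBifiltration t E F) (s a : ℤ) (g : G) :
    (t ^ s) g ∈ E (a + s) ↔ g ∈ E a := by
  induction s generalizing a with
  | zero => simp
  | succ n ih =>
    rw [add_comm (n : ℤ) 1, zpow_add, zpow_one, show a + (1 + (n : ℤ)) = (a + n) + 1 by ring]
    exact (h.map_lower _ _).trans (ih a)
  | pred n ih =>
    rw [← ih, ← h.map_lower, show a + (-(n : ℤ) - 1) + 1 = a + -n by ring]
    rw [show (-(n : ℤ)) = 1 + (-n - 1) by ring, zpow_add t 1, zpow_one]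
    simp

theorem pow_mem_upper (h : IsBifiltration t E F) (s b : ℤ) (g : G) :
    (t ^ s) g ∈ F (b + s) ↔ g ∈ F b := by
  induction s generalizing b with
  | zero => simp
  | succ n ih =>
    rw [add_comm (n : ℤ) 1, zpow_add, zpow_one, show b + (1 + (n : ℤ)) = (b + n) + 1 by ring]
    exact (h.map_upper _ _).trans (ih b)
  | pred n ih =>
    rw [← ih, ← h.map_upper, show b + (-(n : ℤ) - 1) + 1 = b + -n by ring]
    rw [show (-(n : ℤ)) = 1 + (-n - 1) by ring, zpow_add t 1, zpow_one]
    simp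

theorem shift_lower (h : IsBifiltration t E F) {a a' : ℤ} (s : ℤ) {g : G} (e : a' = a + s) :
    (t ^ s) g ∈ E a' ↔ g ∈ E a := by rw [e, h.pow_mem_lower]

theorem shift_upper (h : IsBifiltration t E F) {a a' : ℤ} (s : ℤ) {g : G} (e : a' = a + s) :
    (t ^ s) g ∈ F a' ↔ g ∈ F a := by rw [e, h.pow_mem_upper]

/-- All intersections `E a ⊓ F b` with `b - a < k` are commutative. -/
def CommBelow (E F : ℤ → Subgroup G) (k : ℤ) : Prop :=
  ∀ a b, b - a < k → ∀ g h, g ∈ E a → g ∈ F b → h ∈ E a → h ∈ F b → Commute g h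

/-- Some element of an intersection `E a ⊓ F b` with `b - a = m` is not in `E (a + 1)`. -/
def LowerJump (E F : ℤ → Subgroup G) (m : ℤ) : Prop :=
  ∀ a b, b - a = m → ∃ g, g ∈ E a ∧ g ∈ F b ∧ g ∉ E (a + 1)

/-- Some element of an intersection `E a ⊓ F b` with `b - a = m` is not in `F (b - 1)`. -/
def UpperJump (E F : ℤ → Subgroup G) (m : ℤ) : Prop :=
  ∀ a b, b - a = m → ∃ g, g ∈ E a ∧ g ∈ F b ∧ g ∉ F (b - 1)

theorem CommBelow.reverse {k : ℤ} (h : CommBelow E F k) :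
    CommBelow (fun a => F (-a)) (fun b => E (-b)) k :=
  fun a b hab g g' h1 h2 h3 h4 => h (-b) (-a) (by omega) g g' h2 h1 h4 h3

theorem UpperJump.reverse {m : ℤ} (h : UpperJump E F m) :
    LowerJump (fun a => F (-a)) (fun b => E (-b)) m := fun a b hab => by
  obtain ⟨g, h1, h2, h3⟩ := h (-b) (-a) (by omega)
  exact ⟨g, h2, h1, by rwa [show -a - 1 = -(a + 1) by ring] at h3⟩

theorem LowerJump.reverse {m : ℤ} (h : LowerJump E F m) :
    UpperJump (fun a => F (-a)) (fun b => E (-b)) m := fun a b hab => by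
  obtain ⟨g, h1, h2, h3⟩ := h (-b) (-a) (by omega)
  exact ⟨g, h2, h1, by rwa [show -b + 1 = -(b - 1) by ring] at h3⟩

theorem lowerJump_of_exists (h : IsBifiltration t E F) {a b : ℤ} {g : G} (h1 : g ∈ E a)
    (h2 : g ∈ F b) (h3 : g ∉ E (a + 1)) : LowerJump E F (b - a) := fun a' b' e =>
  ⟨(t ^ (a' - a)) g, (h.shift_lower _ (by ring)).2 h1, (h.shift_upper _ (by omega)).2 h2,
    fun h4 => h3 ((h.shift_lower _ (by ring)).1 h4)⟩

theorem upperJump_of_exists (h : IsBifiltration t E F) {a b : ℤ} {g : G} (h1 : g ∈ E a)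
    (h2 : g ∈ F b) (h3 : g ∉ F (b - 1)) : UpperJump E F (b - a) := fun a' b' e =>
  ⟨(t ^ (a' - a)) g, (h.shift_lower _ (by ring)).2 h1, (h.shift_upper _ (by omega)).2 h2,
    fun h4 => h3 ((h.shift_upper _ (by omega)).1 h4)⟩

theorem LowerJump.mono (h : IsBifiltration t E F) {m n : ℤ} (hm : LowerJump E F m) (hmn : m ≤ n) :
    LowerJump E F n := fun a b e => by
  obtain ⟨g, h1, h2, h3⟩ := hm a (b - (n - m)) (by omega)
  exact ⟨g, h1, h.upper_mono (by omega) h2, h3⟩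

/-- A factor from `F (m - 1)` can push an element one step deeper into `E` without affecting its
jump in `F`. -/
theorem UpperJump.pred (h : IsBifiltration t E F) {m : ℤ} (hm : LowerJump E F (m - 1))
    (hm' : UpperJump E F m) : UpperJump E F (m - 1) := by
  obtain ⟨u, u1, u2, u3⟩ := hm' 0 m (by ring)
  obtain ⟨v, v1, v2, v3⟩ := hm 0 (m - 1) (by ring)
  obtain ⟨n, hn⟩ := h.lower_cyclic 0 u v u1 v1 v3
  have hvn : v ^ n ∈ F (m - 1) := Subgroup.zpow_mem _ v2 n
  refine h.upperJump_of_exists (a := 1) (b := m) hn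
    (mul_mem u2 (h.upper_mono (by omega) hvn)) fun h4 => u3 ?_
  exact (Subgroup.mul_mem_cancel_right _ hvn).1 h4

theorem UpperJump.of_lowerJump (h : IsBifiltration t E F) {k : ℤ} (hk : UpperJump E F k) {m : ℤ}
    (hm : LowerJump E F m) (hmk : m ≤ k) : UpperJump E F m := by
  obtain ⟨j, rfl⟩ : ∃ j : ℕ, k = m + j := ⟨(k - m).toNat, by omega⟩
  induction j with
  | zero => simpa using hk
  | succ j ih =>
    refine ih ?_ (by omega)
    have := UpperJump.pred h (m := m + (j + 1 : ℕ)) (LowerJump.mono h hm (by push_cast; omega)) hk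
    rwa [show m + ((j + 1 : ℕ) : ℤ) - 1 = m + j by push_cast; ring] at this

/-- With no jumps at length `m`, the pair `(a, b)` can be slid indefinitely in both directions while
`g` stays in the intersection; separatedness then applies. -/
theorem eq_one_of_not_jump (h : IsBifiltration t E F) {m : ℤ} (h1 : ¬LowerJump E F m)
    (h2 : ¬UpperJump E F m) {a b : ℤ} (hab : b - a = m) {g : G} (ha : g ∈ E a) (hb : g ∈ F b) :
    g = 1 := by
  have key1 : ∀ j : ℕ, g ∈ E (a + j) := fun j => by
    induction j with
    | zero => simpa using ha
    | succ j ih =>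
      by_contra hc
      push_cast at hc
      rw [← add_assoc] at hc
      refine h1 ?_
      have := h.lowerJump_of_exists (b := b + j) ih (h.upper_mono (by omega) hb) hc
      rwa [show b + (j : ℤ) - (a + j) = m by omega] at this
  have key2 : ∀ j : ℕ, g ∈ F (b - j) := fun j => by
    induction j with
    | zero => simpa using hb
    | succ j ih =>
      by_contra hc
      push_cast at hc
      rw [← sub_sub] at hc
      refine h2 ?_
      have := h.upperJump_of_exists (a := a - j) (h.lower_anti (by omega) ha) ih hc
      rwa [show b - (j : ℤ) - (a - j) = m by omega] at this
  refine h.separated g (fun c => h.lower_anti ?_ (key1 (c - a).toNat))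
    fun c => h.upper_mono ?_ (key2 (b - c).toNat) <;> omega

/-- `E 0 ⊓ F k` is generated by `v`, `u` and `E 1 ⊓ F (k - 1)`. All pairs of generators other than
`v`, `u` commute, being equal or lying in a shorter intersection. -/
theorem not_commute_of_jump (h : IsBifiltration t E F) {k : ℤ} (hk : CommBelow E F k)
    (hk' : ¬CommBelow E F (k + 1)) {u v : G} (v1 : v ∈ E 0) (v2 : v ∈ F (k - 1)) (v3 : v ∉ E 1)
    (u1 : u ∈ E 1) (u2 : u ∈ F k) (u3 : u ∉ F (k - 1)) : ¬Commute v u := by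
  intro huv
  have key : ∀ g, g ∈ E 0 → g ∈ F k →
      ∃ m n : ℤ, ∃ z, g = z * u ^ m * v ^ n ∧ z ∈ E 1 ∧ z ∈ F (k - 1) := fun g g1 g2 => by
    obtain ⟨n, hn⟩ := h.lower_cyclic 0 g v g1 v1 v3
    have h3 : g * v ^ n ∈ F k :=
      mul_mem g2 (Subgroup.zpow_mem _ (h.upper_mono (by omega) v2) n)
    obtain ⟨m, hm⟩ := h.upper_cyclic k _ u h3 u2 u3
    exact ⟨-m, -n, g * v ^ n * u ^ m, by group,
      mul_mem hn (Subgroup.zpow_mem _ u1 m), hm⟩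
  refine hk' fun a b hab g g' g1 g2 g3 g4 => ?_
  by_cases hab' : b - a < k
  · exact hk a b hab' g g' g1 g2 g3 g4
  have e : b = k + a := by omega
  have hs : ∀ g, g ∈ E a → g ∈ F b → (t ^ (-a)) g ∈ E 0 ∧ (t ^ (-a)) g ∈ F k := fun g g1 g2 =>
    ⟨(h.shift_lower _ (by ring)).2 g1, (h.shift_upper _ (by omega)).2 g2⟩
  suffices H : Commute ((t ^ (-a)) g) ((t ^ (-a)) g') from
    (t ^ (-a)).injective (by simpa only [map_mul] using H.eq)
  obtain ⟨m, n, z, hz, z1, z2⟩ := key _ (hs g g1 g2).1 (hs g g1 g2).2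
  obtain ⟨m', n', z', hz', z1', z2'⟩ := key _ (hs g' g3 g4).1 (hs g' g3 g4).2
  have c1 : ∀ z, z ∈ E 1 → z ∈ F (k - 1) → Commute z u ∧ Commute z v := fun z z1 z2 =>
    ⟨hk 1 k (by omega) z u z1 (h.upper_mono (by omega) z2) u1 u2,
      hk 0 (k - 1) (by omega) z v (h.lower_anti (by omega) z1) z2 v1 v2⟩
  have c2 : Commute z z' := hk 1 (k - 1) (by omega) z z' z1 z2 z1' z2'
  rw [hz, hz']
  have zu := (c1 z z1 z2).1
  have zv := (c1 z z1 z2).2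
  have zu' := (c1 z' z1' z2').1
  have zv' := (c1 z' z1' z2').2
  refine Commute.mul_left (Commute.mul_left ?_ ?_) ?_ <;>
    refine Commute.mul_right (Commute.mul_right ?_ ?_) ?_
  · exact c2
  · exact zu.zpow_right _
  · exact zv.zpow_right _
  · exact (zu'.zpow_right _).symm
  · exact (Commute.refl u).zpow_zpow _ _
  · exact huv.symm.zpow_zpow _ _
  · exact (zv'.zpow_right _).symm
  · exact huv.zpow_zpow _ _
  · exact (Commute.refl v).zpow_zpow _ _

theorem exists_commBelow (h : IsBifiltration t E F) {g g' : G} (hg : ¬Commute g g') :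
    ∃ k : ℤ, CommBelow E F k ∧ ¬CommBelow E F (k + 1) := by
  obtain ⟨a, ha⟩ := h.lower_exhaustive g
  obtain ⟨a', ha'⟩ := h.lower_exhaustive g'
  obtain ⟨b, hb⟩ := h.upper_exhaustive g
  obtain ⟨b', hb'⟩ := h.upper_exhaustive g'
  have hex : ∃ k : ℕ, ¬CommBelow E F (k + 1) := by
    refine ⟨(max b b' - min a a').toNat, fun hc => hg ?_⟩
    exact hc (min a a') (max b b') (by omega) g g' (h.lower_anti (min_le_left _ _) ha)
      (h.upper_mono (le_max_left _ _) hb) (h.lower_anti (min_le_right _ _) ha')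
      (h.upper_mono (le_max_right _ _) hb')
  classical
  have h0 : CommBelow E F ((0 : ℕ) + 1) := fun a b hab g g' h1 h2 h3 h4 =>
    h.commute a g g' h1 (h.upper_mono (by push_cast at hab; omega) h2) h3
      (h.upper_mono (by push_cast at hab; omega) h4)
  have hpos : 0 < Nat.find hex := by
    rw [Nat.pos_iff_ne_zero]
    intro h1
    exact (h1 ▸ Nat.find_spec hex) h0
  obtain ⟨j, hj⟩ : ∃ j, Nat.find hex = j + 1 := ⟨Nat.find hex - 1, by omega⟩
  refine ⟨Nat.find hex, ?_, Nat.find_spec hex⟩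
  have := not_not.1 (Nat.find_min hex (m := j) (by omega))
  rwa [hj, Nat.cast_succ]

theorem lowerJump_of_commBelow (h : IsBifiltration t E F) {k : ℤ} (hk : CommBelow E F k)
    (hk' : ¬CommBelow E F (k + 1)) : LowerJump E F k := by
  by_contra hc
  refine hk' fun a b hab g g' g1 g2 g3 g4 => ?_
  by_cases hab' : b - a < k
  · exact hk a b hab' g g' g1 g2 g3 g4
  have e : b - a = k := by omega
  have hE : ∀ g, g ∈ E a → g ∈ F b → g ∈ E (a + 1) := fun g g1 g2 => by
    by_contra h3
    exact hc (e ▸ h.lowerJump_of_exists g1 g2 h3)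
  exact hk (a + 1) b (by omega) g g' (hE g g1 g2) g2 (hE g' g3 g4) g4

theorem upperJump_of_commBelow (h : IsBifiltration t E F) {k : ℤ} (hk : CommBelow E F k)
    (hk' : ¬CommBelow E F (k + 1)) : UpperJump E F k := by
  have := (h.reverse.lowerJump_of_commBelow hk.reverse fun hc => hk' <| by
    simpa using hc.reverse).reverse
  simpa using this

/-- Without this jump there is no lower jump at `k - 1` either, so intersections of length `k - 1`
are trivial and those of length `k` are cyclic, hence commutative. -/
theorem upperJump_pred_of_commBelow (h : IsBifiltration t E F) {k : ℤ} (hk : CommBelow E F k)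
    (hk' : ¬CommBelow E F (k + 1)) : UpperJump E F (k - 1) := by
  by_contra hc
  have hL : ¬LowerJump E F (k - 1) := fun hL =>
    hc (UpperJump.of_lowerJump h (h.upperJump_of_commBelow hk hk') hL (by omega))
  refine hk' fun a b hab g g' g1 g2 g3 g4 => ?_
  by_cases hab' : b - a < k
  · exact hk a b hab' g g' g1 g2 g3 g4
  have e : b - a = k := by omega
  obtain ⟨u, u1, u2, u3⟩ := h.lowerJump_of_commBelow hk hk' a b e
  have key : ∀ g, g ∈ E a → g ∈ F b → ∃ n : ℤ, g = u ^ n := fun g g1 g2 => by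
    obtain ⟨n, hn⟩ := h.lower_cyclic a g u g1 u1 u3
    refine ⟨-n, ?_⟩
    rw [zpow_neg, ← mul_eq_one_iff_eq_inv]
    exact h.eq_one_of_not_jump hL hc (b := b) (by omega) hn
      (mul_mem g2 (Subgroup.zpow_mem _ u2 n))
  obtain ⟨n, rfl⟩ := key g g1 g2
  obtain ⟨n', rfl⟩ := key g' g3 g4
  exact (Commute.refl u).zpow_zpow _ _

theorem lowerJump_pred_of_commBelow (h : IsBifiltration t E F) {k : ℤ} (hk : CommBelow E F k)
    (hk' : ¬CommBelow E F (k + 1)) : LowerJump E F (k - 1) := by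
  have := (h.reverse.upperJump_pred_of_commBelow hk.reverse fun hc => hk' <| by
    simpa using hc.reverse).reverse
  simpa using this

theorem commutator_mul_zpow {v u z : G} (hvz : Commute v z) (hyu : Commute ⁅v, u⁆ u)
    (hyz : Commute ⁅v, u⁆ z) (m : ℤ) : ⁅v, z * u ^ m⁆ = ⁅v, u⁆ ^ m := by
  have h1 : v * u * v⁻¹ = ⁅v, u⁆ * u := by rw [commutatorElement_def]; group
  have h2 : v * u ^ m * v⁻¹ = ⁅v, u⁆ ^ m * u ^ m := by
    rw [← conj_zpow, h1, hyu.mul_zpow]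
  calc ⁅v, z * u ^ m⁆ = v * z * u ^ m * v⁻¹ * (u ^ m)⁻¹ * z⁻¹ := by
        rw [commutatorElement_def]; group
    _ = z * (v * u ^ m * v⁻¹) * (u ^ m)⁻¹ * z⁻¹ := by rw [hvz.eq]; group
    _ = z * ⁅v, u⁆ ^ m * z⁻¹ := by rw [h2]; group
    _ = ⁅v, u⁆ ^ m := by rw [← (hyz.zpow_left m).eq]; group

/-- If `u` realises an upper jump and lies deep enough in the lower filtration, then `⁅v, u⁆` cannot
lie in `E i` but not in `E (i + 1)`. -/
theorem commutator_mem_lower_succ (h : IsBifiltration t E F) {k : ℤ} (hk : CommBelow E F k)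
    (hk' : ¬CommBelow E F (k + 1)) {u v : G} (v1 : v ∈ E 0) (v2 : v ∈ F (k - 1))
    (v3 : v ∉ E 1) {i : ℤ} (hi : 1 ≤ i) (u1 : u ∈ E (i + 1)) (u2 : u ∈ F k) (u3 : u ∉ F (k - 1))
    (hy : ⁅v, u⁆ ∈ E i) : ⁅v, u⁆ ∈ E (i + 1) := by
  by_contra hy'
  have u0 : u ∈ E 1 := h.lower_anti (by omega) u1
  have hyF : ⁅v, u⁆ ∈ F (k - 1) := h.upper_comm k v u (h.upper_mono (by omega) v2) u2
  have hvu := h.not_commute_of_jump hk hk' v1 v2 v3 u0 u2 u3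
  have us1 : ∀ s c : ℤ, c ≤ i + 1 + s → (t ^ s) u ∈ E c := fun s c hc =>
    h.lower_anti hc ((h.shift_lower s rfl).2 u1)
  have us2 : ∀ s c : ℤ, k + s ≤ c → (t ^ s) u ∈ F c := fun s c hc =>
    h.upper_mono hc ((h.shift_upper s rfl).2 u2)
  set w := (t ^ i) u with hw
  have huw : Commute u w := hk (i + 1) (i + k) (by omega) u w u1 (h.upper_mono (by omega) u2)
    (us1 _ _ (by omega)) (us2 _ _ (by omega))
  -- Translates of `u` strip the top layers of `d` in `F`. Each translate lies deep enough in `E` to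
  -- share an intersection of length below `k` with `u` and with `⁅v, u⁆`.
  have peel : ∀ j : ℕ, (j : ℤ) < i → ∀ d, d ∈ E 1 → d ∈ F (k + j) →
      Commute d u ∧ Commute d ⁅v, u⁆ := fun j => by
    induction j with
    | zero =>
      intro _ d d1 d2
      simp only [Nat.cast_zero, add_zero] at d2
      exact ⟨hk 1 k (by omega) d u d1 d2 u0 u2, hk 1 k (by omega) d _ d1 d2
        (h.lower_anti (by omega) hy) (h.upper_mono (by omega) hyF)⟩
    | succ j ih =>
      intro hj d d1 d2
      push_cast at hj d2
      set r := (t ^ ((j : ℤ) + 1)) u with hr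
      have r1 : ∀ c : ℤ, c ≤ i + 1 + (j + 1) → r ∈ E c := us1 _
      have r2 : ∀ c : ℤ, k + (j + 1) ≤ c → r ∈ F c := us2 _
      have r3 : r ∉ F (k + (j + 1) - 1) := fun hc => u3 ((h.shift_upper _ (by ring)).1 hc)
      obtain ⟨n, hn⟩ := h.upper_cyclic _ d r d2 (r2 _ le_rfl) r3
      obtain ⟨c1, c2⟩ := ih (by omega) (d * r ^ n)
        (mul_mem d1 (Subgroup.zpow_mem _ (r1 _ (by omega)) n)) (h.upper_mono (by omega) hn)
      have c3 : Commute r u := hk (i + 1) (k + (j + 1)) (by omega) r u (r1 _ (by omega))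
        (r2 _ le_rfl) u1 (h.upper_mono (by omega) u2)
      have c4 : Commute r ⁅v, u⁆ := hk i (k + (j + 1)) (by omega) r _ (r1 _ (by omega))
        (r2 _ le_rfl) hy (h.upper_mono (by omega) hyF)
      have e : d = d * r ^ n * r ^ (-n) := by group
      rw [e]
      exact ⟨c1.mul_left (c3.zpow_left _), c2.mul_left (c4.zpow_left _)⟩
  have w0 : w ∈ F (k + i) := us2 _ _ le_rfl
  obtain ⟨du, dy⟩ := peel (i - 1).toNat (by omega) ⁅v, w⁆
    (h.lower_comm 0 v w v1 (us1 _ _ (by omega)))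
    (h.upper_mono (by omega) (h.upper_comm (k + i) v w (h.upper_mono (by omega) v2) w0))
  have yu : Commute ⁅v, u⁆ u := (peel 0 (by push_cast; omega) _ (h.lower_anti hi hy)
    (h.upper_mono (by simp) hyF)).1
  have conj : ∀ g, v * g * v⁻¹ = ⁅v, g⁆ * g := fun g => by rw [commutatorElement_def]; group
  -- Conjugating `Commute u w` by `v`; the known commutations then leave only `Commute ⁅v, u⁆ w`.
  have H : Commute (⁅v, u⁆ * u) (⁅v, w⁆ * w) := by
    rw [← conj, ← conj]
    exact (Commute.conj_iff v).2 huw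
  have H1 : Commute u (⁅v, w⁆ * w) := du.symm.mul_right huw
  have H2 : Commute ⁅v, u⁆ (⁅v, w⁆ * w) := by
    have := H.mul_left H1.inv_left
    rwa [mul_inv_cancel_right] at this
  have H3 : Commute ⁅v, u⁆ w := by
    have := dy.symm.inv_right.mul_right H2
    rwa [inv_mul_cancel_left] at this
  set q := (t ^ i) v with hq
  have q1 : q ∈ E i := (h.shift_lower i (by ring)).2 v1
  have q2 : q ∈ F (i + k - 1) := (h.shift_upper i (by ring)).2 v2
  -- The assumed jump of `⁅v, u⁆` at `i` is used here: its powers correct the translate of `v` into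
  -- `E (i + 1)`, where it must commute with `w`.
  obtain ⟨n, hn⟩ := h.lower_cyclic i q _ q1 hy hy'
  have H4 : Commute (q * ⁅v, u⁆ ^ n) w := hk (i + 1) (i + k) (by omega) _ w hn
    (mul_mem (h.upper_mono (by omega) q2)
      (Subgroup.zpow_mem _ (h.upper_mono (by omega) hyF) n)) (us1 _ _ (by omega)) (us2 _ _ (by omega))
  have H5 : Commute q w := by
    have := H4.mul_left (H3.zpow_left (-n))
    rwa [mul_assoc, ← zpow_add, add_neg_cancel, zpow_zero, mul_one] at this
  exact hvu ((t ^ i).injective (by simpa only [map_mul] using H5.eq))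

/-- The commutator of elements realising the jumps at the shortest noncommutative length lies in
every `E a`. -/
theorem commutator_mem_lower (h : IsBifiltration t E F) {k : ℤ} (hk : CommBelow E F k)
    (hk' : ¬CommBelow E F (k + 1)) {u v : G} (v1 : v ∈ E 0) (v2 : v ∈ F (k - 1))
    (v3 : v ∉ E 1) (u1 : u ∈ E 1) (u2 : u ∈ F k) (u3 : u ∉ F (k - 1)) (a : ℤ) :
    ⁅v, u⁆ ∈ E a := by
  have v2' : v ∈ F k := h.upper_mono (by omega) v2
  have hmem : ∀ u, u ∈ E 1 → u ∈ F k → ⁅v, u⁆ ∈ E 1 ∧ ⁅v, u⁆ ∈ F (k - 1) := fun u u1 u2 =>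
    ⟨h.lower_comm 0 v u v1 (h.lower_anti (by omega) u1), h.upper_comm k v u v2' u2⟩
  -- Modulo `E 1 ⊓ F (k - 1)`, which commutes with `v`, `u'` is a power of `u`.
  have hpow : ∀ u u', u ∈ E 1 → u ∈ F k → u ∉ F (k - 1) → u' ∈ E 1 → u' ∈ F k →
      ∃ m : ℤ, ⁅v, u'⁆ = ⁅v, u⁆ ^ m := fun u u' u1 u2 u3 u1' u2' => by
    obtain ⟨n, hn⟩ := h.upper_cyclic k u' u u2' u2 u3
    have hn' : u' * u ^ n ∈ E 1 := mul_mem u1' (Subgroup.zpow_mem _ u1 n)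
    obtain ⟨y1, y2⟩ := hmem u u1 u2
    refine ⟨-n, ?_⟩
    rw [← commutator_mul_zpow (z := u' * u ^ n)
      (hk 0 (k - 1) (by omega) _ _ v1 v2 (h.lower_anti (by omega) hn') hn)
      (hk 1 k (by omega) _ _ y1 (h.upper_mono (by omega) y2) u1 u2)
      (hk 1 (k - 1) (by omega) _ _ y1 y2 hn' hn) (-n), zpow_neg, mul_inv_cancel_right]
  suffices H : ∀ j : ℕ, ⁅v, u⁆ ∈ E (1 + j) from h.lower_anti (by omega) (H (a - 1).toNat)
  intro j
  induction j with
  | zero => simpa using (hmem u u1 u2).1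
  | succ j ih =>
    by_contra hc
    push_cast at hc
    rw [← add_assoc] at hc
    -- The jump of `⁅v, u⁆` at `1 + j` has length `k - 1 - (1 + j)`. An upper jump of that same
    -- length supplies a substitute for `u` lying deeper in `E`.
    obtain ⟨u', w1, w2, w3⟩ := UpperJump.of_lowerJump h (h.upperJump_pred_of_commBelow hk hk')
      (h.lowerJump_of_exists ih (hmem u u1 u2).2 hc) (by omega) (1 + j + 1) k (by ring)
    have w0 : u' ∈ E 1 := h.lower_anti (by omega) w1
    obtain ⟨m, hm⟩ := hpow u u' u1 u2 u3 w0 w2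
    obtain ⟨m', hm'⟩ := hpow u' u w0 w2 w3 u1 u2
    have := h.commutator_mem_lower_succ hk hk' v1 v2 v3 (by omega) w1 w2 w3
      (hm ▸ Subgroup.zpow_mem _ ih m)
    exact hc (hm' ▸ Subgroup.zpow_mem _ this m')

theorem commute_all (h : IsBifiltration t E F) (g g' : G) : Commute g g' := by
  by_contra hg
  obtain ⟨k, hk, hk'⟩ := h.exists_commBelow hg
  obtain ⟨v, v1, v2, v3⟩ := h.lowerJump_pred_of_commBelow hk hk' 0 (k - 1) (by ring)
  obtain ⟨u, u1, u2, u3⟩ := h.upperJump_pred_of_commBelow hk hk' 1 k (by ring)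
  rw [zero_add] at v3
  refine h.not_commute_of_jump hk hk' v1 v2 v3 u1 u2 u3 ?_
  rw [← commutatorElement_eq_one_iff_commute]
  refine h.separated _ (h.commutator_mem_lower hk hk' v1 v2 v3 u1 u2 u3) fun b => ?_
  -- Reversal exchanges the roles of `u` and `v`; the shift by `-k` brings `F k` to index `0`.
  have hr := h.reverse.commutator_mem_lower (u := (t ^ (-k)) v) (v := (t ^ (-k)) u) hk.reverse
    (fun hc => hk' <| by simpa using hc.reverse) ?_ ?_ ?_ ?_ ?_ ?_ (-(b - k))
  · rw [← commutatorElement_inv, inv_mem_iff, ← map_commutatorElement, neg_neg] at hr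
    exact (h.shift_upper _ (by ring)).1 hr
  · exact (h.shift_upper _ (by ring)).2 u2
  · exact (h.shift_lower _ (by ring)).2 u1
  · exact fun hc => u3 ((h.shift_upper _ (by ring)).1 hc)
  · exact (h.shift_upper _ (by ring)).2 v2
  · exact (h.shift_lower _ (by ring)).2 v1
  · exact fun hc => v3 ((h.shift_lower _ (by ring)).1 hc)

end IsBifiltration

end Bifiltration

/-! ### Prime-index subgroups and central elements of finite p-groups. -/

section PrimeIndex

variable {G : Type*} [Group G] {p k : ℕ}

theorem Subgroup.normal_of_index_eq_prime_of_card_eq_pow (hp : p.Prime) (hG : Nat.card G = p ^ k)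
    {N : Subgroup G} (hN : N.index = p) : N.Normal := by
  refine Subgroup.normal_of_index_eq_minFac_card ?_
  have hk : k ≠ 0 := by
    rintro rfl
    have h := N.index_dvd_card
    rw [hG, hN, pow_zero, Nat.dvd_one] at h
    exact hp.one_lt.ne' h
  rw [hG, hN, hp.pow_minFac hk]

open scoped commutatorElement in
theorem Subgroup.commutatorElement_mem_of_index_eq_prime (hp : p.Prime) (hG : Nat.card G = p ^ k)
    {N : Subgroup G} (hN : N.index = p) (g h : G) : ⁅g, h⁆ ∈ N := by
  have := Subgroup.normal_of_index_eq_prime_of_card_eq_pow hp hG hN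
  have : Fact p.Prime := ⟨hp⟩
  have hc : IsCyclic (G ⧸ N) := isCyclic_of_prime_card (p := p) hN
  rw [← QuotientGroup.eq_one_iff, commutatorElement_def, QuotientGroup.mk_mul,
    QuotientGroup.mk_mul, QuotientGroup.mk_mul, QuotientGroup.mk_inv, QuotientGroup.mk_inv,
    ← commutatorElement_def, commutatorElement_eq_one_iff_mul_comm]
  exact hc.isMulCommutative.is_comm.comm _ _

theorem Subgroup.exists_mul_zpow_mem_of_index_eq_prime (hp : p.Prime) (hG : Nat.card G = p ^ k)
    {N : Subgroup G} (hN : N.index = p) (g : G) {h : G} (hh : h ∉ N) : ∃ n : ℤ, g * h ^ n ∈ N := by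
  have := Subgroup.normal_of_index_eq_prime_of_card_eq_pow hp hG hN
  have : Fact p.Prime := ⟨hp⟩
  have hh' : (h : G ⧸ N) ≠ 1 := by rwa [Ne, QuotientGroup.eq_one_iff]
  obtain ⟨n, hn⟩ := mem_zpowers_of_prime_card (G := G ⧸ N) (p := p) hN (g := (h : G ⧸ N))
    (g' := (g : G ⧸ N)⁻¹) hh'
  refine ⟨n, ?_⟩
  rw [← QuotientGroup.eq_one_iff, QuotientGroup.mk_mul, QuotientGroup.mk_zpow]
  simp only at hn
  rw [hn, mul_inv_cancel]

/-- A subgroup of small index in a large `p`-group contains a nontrivial central element. -/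
theorem Subgroup.exists_mem_center_of_factorial_index_lt [Finite G] (hp : p.Prime)
    (hG : Nat.card G = p ^ k) {H : Subgroup G} (hH : H.index.factorial < p ^ k) :
    ∃ z ∈ H, z ≠ 1 ∧ z ∈ Subgroup.center G := by
  have : Fact p.Prime := ⟨hp⟩
  -- The quotient by the normal core acts faithfully on the cosets of `H`.
  have hcard : Nat.card G ≤ Nat.card H.normalCore * H.index.factorial := by
    rw [← H.normalCore.card_mul_index]
    refine Nat.mul_le_mul_left _ ?_
    have h1 := Subgroup.index_ker (MulAction.toPermHom G (G ⧸ H))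
    rw [← Subgroup.normalCore_eq_ker] at h1
    rw [h1, Subgroup.index_eq_card, ← Nat.card_perm]
    exact Nat.card_le_card_of_injective _ Subtype.val_injective
  have hne : H.normalCore ≠ ⊥ := by
    intro h
    rw [h, Subgroup.card_bot, one_mul, hG] at hcard
    omega
  have hnt : Nontrivial H.normalCore := (Subgroup.nontrivial_iff_ne_bot _).2 hne
  have hP : IsPGroup p G := IsPGroup.of_card hG
  have hpc : p ∣ Nat.card H.normalCore := by
    obtain ⟨n, hn, h⟩ := (hP.to_subgroup H.normalCore).nontrivial_iff_card.1 hnt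
    exact h ▸ dvd_pow_self p hn.ne'
  obtain ⟨z, hz, hz1⟩ := IsPGroup.exists_fixed_point_of_prime_dvd_card_of_fixed_point
    (hP.of_equiv ConjAct.toConjAct) H.normalCore hpc (a := 1) (fun g => smul_one g)
  refine ⟨z, H.normalCore_le z.2, fun h => hz1 (Subtype.ext h.symm), ?_⟩
  rw [Subgroup.mem_center_iff]
  intro g
  have := congrArg Subtype.val (hz (ConjAct.toConjAct g))
  rw [ConjAct.Subgroup.val_conj_smul, ConjAct.toConjAct_smul] at this
  exact mul_inv_eq_iff_eq_mul.1 this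

end PrimeIndex

/-! ### Windows and rays of a ℤ-system. -/

namespace IsZSystem

/-- The subgroup generated by the elements with index in `[n, m]`. -/
def window {X : Type*} [Group X] (x : ℤ → X) (n m : ℤ) : Subgroup X :=
  Subgroup.closure (x '' Set.Icc n m)

/-- The subgroup generated by the elements with index at least `a`. -/
def ray {X : Type*} [Group X] (x : ℤ → X) (a : ℤ) : Subgroup X :=
  Subgroup.closure (x '' Set.Ici a)

section Window

open scoped commutatorElement

variable {X : Type*} [Group X] {p : ℕ} {x : ℤ → X}

theorem window_mono {n m n' m' : ℤ} (hn : n' ≤ n) (hm : m ≤ m') :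
    window x n m ≤ window x n' m' :=
  Subgroup.closure_mono (Set.image_mono (Set.Icc_subset_Icc hn hm))

theorem ray_anti {a b : ℤ} (h : a ≤ b) : ray x b ≤ ray x a :=
  Subgroup.closure_mono (Set.image_mono (Set.Ici_subset_Ici.2 h))

theorem window_le_ray {a n m : ℤ} (h : a ≤ n) : window x n m ≤ ray x a :=
  Subgroup.closure_mono (Set.image_mono fun _ hi => h.trans hi.1)

theorem apply_mem_window {n m i : ℤ} (h1 : n ≤ i) (h2 : i ≤ m) : x i ∈ window x n m :=
  Subgroup.subset_closure ⟨i, ⟨h1, h2⟩, rfl⟩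

theorem window_eq_bot {n m : ℤ} (h : m < n) : window x n m = ⊥ := by
  rw [window, Set.Icc_eq_empty (by omega), Set.image_empty, Subgroup.closure_empty]

theorem mem_ray_iff {a : ℤ} {g : X} : g ∈ ray x a ↔ ∃ m, g ∈ window x a m := by
  refine ⟨fun h => ?_, fun ⟨m, hm⟩ => window_le_ray le_rfl hm⟩
  induction h using Subgroup.closure_induction with
  | mem g hg =>
    obtain ⟨i, hi, rfl⟩ := hg
    exact ⟨i, apply_mem_window hi le_rfl⟩
  | one => exact ⟨a, one_mem _⟩
  | mul g h _ _ hg hh =>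
    obtain ⟨m, hm⟩ := hg
    obtain ⟨m', hm'⟩ := hh
    exact ⟨max m m', mul_mem (window_mono le_rfl (le_max_left _ _) hm)
      (window_mono le_rfl (le_max_right _ _) hm')⟩
  | inv g _ hg =>
    obtain ⟨m, hm⟩ := hg
    exact ⟨m, inv_mem hm⟩

theorem map_window {t : X ≃* X} {c : ℤ} (ht : ∀ n, t (x n) = x (n + c)) (n m : ℤ) :
    (window x n m).map t.toMonoidHom = window x (n + c) (m + c) := by
  rw [window, window, MonoidHom.map_closure, ← Set.image_add_const_Icc, Set.image_image,
    Set.image_image]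
  exact congrArg _ (Set.image_congr fun i _ => ht i)

theorem map_ray {t : X ≃* X} {c : ℤ} (ht : ∀ n, t (x n) = x (n + c)) (a : ℤ) :
    (ray x a).map t.toMonoidHom = ray x (a + c) := by
  rw [ray, ray, MonoidHom.map_closure, ← Set.image_add_const_Ici, Set.image_image,
    Set.image_image]
  exact congrArg _ (Set.image_congr fun i _ => ht i)

theorem shift_mem_ray {t : X ≃* X} {c : ℤ} (ht : ∀ n, t (x n) = x (n + c)) {a : ℤ} {g : X} :
    t g ∈ ray x (a + c) ↔ g ∈ ray x a := by
  rw [← map_ray ht]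
  exact Subgroup.mem_map_iff_mem t.injective

theorem exists_even_shift (hx : IsZSystem p x) (s : ℤ) :
    ∃ t : X ≃* X, ∀ n, t (x n) = x (n + 2 * s) := by
  obtain ⟨t, ht⟩ := hx.exists_shift
  have ht' : ∀ n, t.symm (x n) = x (n - 2) := fun n => by
    rw [MulEquiv.symm_apply_eq, ht, sub_add_cancel]
  induction s using Int.induction_on with
  | zero => exact ⟨MulEquiv.refl X, fun n => by simp⟩
  | succ i ih =>
    obtain ⟨u, hu⟩ := ih
    exact ⟨u.trans t, fun n => by rw [MulEquiv.trans_apply, hu, ht]; congr 1; ring⟩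
  | pred i ih =>
    obtain ⟨u, hu⟩ := ih
    exact ⟨u.trans t.symm, fun n => by rw [MulEquiv.trans_apply, hu, ht']; congr 1; ring⟩

theorem mirror (hx : IsZSystem p x) : IsZSystem p fun n => x (-n) where
  closure_range := by
    rw [← hx.closure_range]
    congr 1
    exact neg_surjective.range_comp x
  card_closure n m h := by
    rw [← Set.image_image x Neg.neg, Set.image_neg_Icc, hx.card_closure _ _ (by omega)]
    congr 2
    ring
  exists_shift := by
    obtain ⟨t, ht⟩ := hx.exists_even_shift (-1)
    exact ⟨t, fun n => by rw [ht]; congr 1; ring⟩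

theorem card_window (hx : IsZSystem p x) {n m : ℤ} (h : n ≤ m + 1) :
    Nat.card (window x n m) = p ^ (m - n + 1).toNat := by
  rcases h.lt_or_eq with h | h
  · exact hx.card_closure n m (by omega)
  · rw [window_eq_bot (by omega), Subgroup.card_bot, h]
    simp

theorem finite_window (hp : p.Prime) (hx : IsZSystem p x) (n m : ℤ) : Finite (window x n m) := by
  rcases le_or_gt n (m + 1) with h | h
  · refine Nat.finite_of_card_ne_zero ?_
    rw [hx.card_window h]
    exact pow_ne_zero _ hp.ne_zero
  · rw [window_eq_bot (by omega)]
    infer_instance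

theorem relIndex_window (hp : p.Prime) (hx : IsZSystem p x) {n m n' m' : ℤ} (hn : n ≤ n')
    (hm : m' ≤ m) (h : n' ≤ m' + 1) :
    (window x n' m').relIndex (window x n m) = p ^ ((n' - n) + (m - m')).toNat := by
  have h1 := ((window x n' m').subgroupOf (window x n m)).card_mul_index
  rw [Nat.card_congr (Subgroup.subgroupOfEquivOfLe (window_mono hn hm)).toEquiv,
    hx.card_window h, hx.card_window (by omega), show (m - n + 1).toNat =
      (m' - n' + 1).toNat + (n' - n + (m - m')).toNat by omega, pow_add] at h1
  exact Nat.eq_of_mul_eq_mul_left (pow_pos hp.pos _) h1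

theorem commutator_mem_window (hp : p.Prime) (hx : IsZSystem p x) {n m : ℤ} (h : n ≤ m) {g k : X}
    (hg : g ∈ window x n m) (hk : k ∈ window x n m) : ⁅g, k⁆ ∈ window x (n + 1) m := by
  have h1 := hx.relIndex_window hp (show n ≤ n + 1 by omega) (le_refl m) (by omega)
  rw [show (n + 1 - n + (m - m)).toNat = 1 by omega, pow_one] at h1
  exact Subgroup.commutatorElement_mem_of_index_eq_prime hp
    (hx.card_window (show n ≤ m + 1 by omega)) h1 ⟨g, hg⟩ ⟨k, hk⟩

theorem exists_mul_zpow_mem_window (hp : p.Prime) (hx : IsZSystem p x) {n m : ℤ} (h : n ≤ m)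
    {g k : X} (hg : g ∈ window x n m) (hk : k ∈ window x n m) (hk' : k ∉ window x (n + 1) m) :
    ∃ i : ℤ, g * k ^ i ∈ window x (n + 1) m := by
  have h1 := hx.relIndex_window hp (show n ≤ n + 1 by omega) (le_refl m) (by omega)
  rw [show (n + 1 - n + (m - m)).toNat = 1 by omega, pow_one] at h1
  exact Subgroup.exists_mul_zpow_mem_of_index_eq_prime hp
    (hx.card_window (show n ≤ m + 1 by omega)) h1 ⟨g, hg⟩ (h := ⟨k, hk⟩) hk'

theorem apply_notMem_window (hp : p.Prime) (hx : IsZSystem p x) {n m : ℤ} (h : n ≤ m) :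
    x n ∉ window x (n + 1) m := by
  intro hc
  have h1 : window x n m ≤ window x (n + 1) m := by
    rw [window, Subgroup.closure_le]
    rintro _ ⟨i, hi, rfl⟩
    rcases hi.1.eq_or_lt with rfl | h2
    · exact hc
    · exact apply_mem_window h2 hi.2
  have h2 := hx.relIndex_window hp (show n ≤ n + 1 by omega) (le_refl m) (by omega)
  rw [Subgroup.relIndex_eq_one.2 h1, show (n + 1 - n + (m - m)).toNat = 1 by omega, pow_one] at h2
  exact hp.one_lt.ne h2

/-- Otherwise `g` would generate the window modulo its index-`p` subgroup, putting `x n` in a window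
that starts at `n + 1`. -/
theorem mem_window_of_mem_ray (hp : p.Prime) (hx : IsZSystem p x) {n m : ℤ} (h : n ≤ m) {g : X}
    (h1 : g ∈ ray x (n + 1)) (h2 : g ∈ window x n m) : g ∈ window x (n + 1) m := by
  by_contra hg
  obtain ⟨m', hm'⟩ := mem_ray_iff.1 h1
  obtain ⟨i, hi⟩ := hx.exists_mul_zpow_mem_window hp h (apply_mem_window le_rfl h) h2 hg
  refine hx.apply_notMem_window hp (h.trans (le_max_left m m')) ?_
  rw [← Subgroup.mul_mem_cancel_right _ (zpow_mem (window_mono le_rfl (le_max_right m m') hm') i)]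
  exact window_mono le_rfl (le_max_left m m') hi

theorem eq_one_of_mem_ray (hp : p.Prime) (hx : IsZSystem p x) {a n m : ℤ} (h : m < a) {g : X}
    (h1 : g ∈ ray x a) (h2 : g ∈ window x n m) : g = 1 := by
  obtain ⟨k, hk⟩ : ∃ k : ℕ, m - n + 1 ≤ k := ⟨(m - n + 1).toNat, by omega⟩
  induction k generalizing n with
  | zero =>
    rw [window_eq_bot (by omega)] at h2
    exact h2
  | succ k ih =>
    rcases lt_or_ge m n with hn | hn
    · rw [window_eq_bot hn] at h2
      exact h2
    · exact ih (hx.mem_window_of_mem_ray hp hn (ray_anti (by omega) h1) h2) (by push_cast at hk; omega)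

theorem exists_notMem_ray (hp : p.Prime) (hx : IsZSystem p x) {n m : ℤ} {g : X}
    (h2 : g ∈ window x n m) (hg : g ≠ 1) :
    ∃ a, n ≤ a ∧ a ≤ m ∧ g ∈ ray x a ∧ g ∉ ray x (a + 1) := by
  obtain ⟨k, hk⟩ : ∃ k : ℕ, m - n + 1 ≤ k := ⟨(m - n + 1).toNat, by omega⟩
  induction k generalizing n with
  | zero =>
    rw [window_eq_bot (by omega)] at h2
    exact (hg h2).elim
  | succ k ih =>
    rcases lt_or_ge m n with hn | hn
    · rw [window_eq_bot hn] at h2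
      exact (hg h2).elim
    by_cases h : g ∈ ray x (n + 1)
    · obtain ⟨a, h3, h4⟩ := ih (hx.mem_window_of_mem_ray hp hn h h2) (by push_cast at hk; omega)
      exact ⟨a, by omega, h4⟩
    · exact ⟨n, le_rfl, hn, window_le_ray le_rfl h2, h⟩

theorem commutator_mem_ray (hp : p.Prime) (hx : IsZSystem p x) {a : ℤ} {g k : X}
    (hg : g ∈ ray x a) (hk : k ∈ ray x a) : ⁅g, k⁆ ∈ ray x (a + 1) := by
  obtain ⟨m, hm⟩ := mem_ray_iff.1 hg
  obtain ⟨m', hm'⟩ := mem_ray_iff.1 hk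
  exact window_le_ray le_rfl (hx.commutator_mem_window hp (m := max a (max m m')) (by simp)
    (window_mono le_rfl (by simp) hm) (window_mono le_rfl (by simp) hm'))

theorem exists_mul_zpow_mem_ray (hp : p.Prime) (hx : IsZSystem p x) {a : ℤ} {g k : X}
    (hg : g ∈ ray x a) (hk : k ∈ ray x a) (hk' : k ∉ ray x (a + 1)) :
    ∃ i : ℤ, g * k ^ i ∈ ray x (a + 1) := by
  obtain ⟨m, hm⟩ := mem_ray_iff.1 hg
  obtain ⟨m', hm'⟩ := mem_ray_iff.1 hk
  obtain ⟨i, hi⟩ := hx.exists_mul_zpow_mem_window hp (m := max a (max m m')) (by simp)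
    (window_mono le_rfl (by simp) hm) (window_mono le_rfl (by simp) hm')
    fun h => hk' (window_le_ray le_rfl h)
  exact ⟨i, window_le_ray le_rfl hi⟩

theorem exists_mem_window (hx : IsZSystem p x) (g : X) : ∃ R : ℤ, g ∈ window x (-R) R := by
  have hg : g ∈ Subgroup.closure (Set.range x) := hx.closure_range ▸ Subgroup.mem_top g
  induction hg using Subgroup.closure_induction with
  | mem g hg =>
    obtain ⟨i, rfl⟩ := hg
    exact ⟨|i|, apply_mem_window (neg_abs_le i) (le_abs_self i)⟩
  | one => exact ⟨0, one_mem _⟩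
  | mul g h _ _ hg hh =>
    obtain ⟨m, hm⟩ := hg
    obtain ⟨m', hm'⟩ := hh
    exact ⟨max m m', mul_mem
      (window_mono (neg_le_neg (le_max_left _ _)) (le_max_left _ _) hm)
      (window_mono (neg_le_neg (le_max_right _ _)) (le_max_right _ _) hm')⟩
  | inv g _ hg =>
    obtain ⟨m, hm⟩ := hg
    exact ⟨m, inv_mem hm⟩

theorem mem_ray_mirror_iff {a : ℤ} {g : X} :
    g ∈ ray (fun n => x (-n)) a ↔ ∃ n, g ∈ window x n (-a) := by
  have h : ∀ m, window (fun n => x (-n)) a m = window x (-m) (-a) := fun m => by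
    rw [window, window, ← Set.image_image x Neg.neg, Set.image_neg_Icc]
  rw [mem_ray_iff]
  exact ⟨fun ⟨m, hm⟩ => ⟨-m, h m ▸ hm⟩, fun ⟨n, hn⟩ => ⟨-n, by rwa [h, neg_neg]⟩⟩

theorem eq_one_of_mem_rays (hp : p.Prime) (hx : IsZSystem p x) {a b : ℤ} (h : 0 < a + b) {g : X}
    (h1 : g ∈ ray x a) (h2 : g ∈ ray (fun n => x (-n)) b) : g = 1 := by
  obtain ⟨n, hn⟩ := mem_ray_mirror_iff.1 h2
  exact hx.eq_one_of_mem_ray hp (by omega) h1 hn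

end Window

end IsZSystem

/-! ### Commuting factors inside commutators. -/

section Commutator

open scoped commutatorElement

variable {G : Type*} [Group G] {z g h : G}

theorem commutatorElement_mul_left_of_commute (hg : Commute z g) (hh : Commute z h) :
    ⁅z * g, h⁆ = ⁅g, h⁆ := by
  have h1 : Commute z (g * h * g⁻¹) := (hg.mul_right hh).mul_right hg.inv_right
  rw [commutatorElement_def, commutatorElement_def, mul_inv_rev, mul_assoc z, mul_assoc z,
    ← mul_assoc (g * h), ← mul_assoc z, h1.eq, mul_inv_cancel_right]

theorem commutatorElement_mul_right_of_commute (hg : Commute z g) (hh : Commute z h) :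
    ⁅g, z * h⁆ = ⁅g, h⁆ := by
  rw [← commutatorElement_inv, commutatorElement_mul_left_of_commute hh hg, commutatorElement_inv]

end Commutator

/-! ### Elements centralizing large windows, and hulls. -/

namespace IsZSystem

section Central

open scoped commutatorElement

open Filter

variable {X : Type*} [Group X] {p : ℕ} {x : ℤ → X}

theorem centralizer_window_anti {R R' : ℤ} (h : R ≤ R') :
    Subgroup.centralizer (window x (-R') R' : Set X) ≤ Subgroup.centralizer (window x (-R) R) :=
  Subgroup.centralizer_le (window_mono (neg_le_neg h) h)

theorem eventually_commute (hx : IsZSystem p x) (g : X) :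
    ∀ᶠ R : ℤ in atTop, ∀ z ∈ Subgroup.centralizer (window x (-R) R : Set X), Commute z g := by
  obtain ⟨R₀, h⟩ := hx.exists_mem_window g
  filter_upwards [eventually_ge_atTop R₀] with R hR z hz
  exact (Subgroup.mem_centralizer_iff.1 hz g (window_mono (neg_le_neg hR) hR h)).symm

/-- There are elements with leading index `a` centralizing arbitrarily large windows. -/
def IsCentralIndex {X : Type*} [Group X] (x : ℤ → X) (a : ℤ) : Prop :=
  ∀ R : ℤ, ∃ z ∈ Subgroup.centralizer (window x (-R) R : Set X), z ∈ ray x a ∧ z ∉ ray x (a + 1)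

theorem exists_mem_centralizer_window (hp : p.Prime) (hx : IsZSystem p x) (R : ℤ) :
    ∃ n a : ℤ, R ≤ a ∧ a ≤ n - R ∧ ∃ z ∈ Subgroup.centralizer (window x 0 n : Set X),
      z ∈ ray x a ∧ z ∉ ray x (a + 1) := by
  wlog hR : 0 ≤ R generalizing R
  · obtain ⟨n, a, h1, h2, h3⟩ := this 0 le_rfl
    exact ⟨n, a, by omega, by omega, h3⟩
  obtain ⟨k, hk⟩ : ∃ k : ℕ, (p ^ (2 * R).toNat).factorial < p ^ k :=
    ⟨_, Nat.lt_pow_self hp.one_lt⟩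
  set n : ℤ := 2 * R + k with hn
  have := hx.finite_window hp 0 n
  have hi : (window x R (n - R)).relIndex (window x 0 n) = p ^ (2 * R).toNat := by
    rw [hx.relIndex_window hp hR (by omega) (by omega)]
    congr 2
    ring
  obtain ⟨z, h1, h2, h3⟩ := Subgroup.exists_mem_center_of_factorial_index_lt hp
    (hx.card_window (show 0 ≤ n + 1 by omega))
    (H := (window x R (n - R)).subgroupOf (window x 0 n)) (by
      rw [← Subgroup.relIndex, hi]
      exact hk.trans_le (Nat.pow_le_pow_right hp.pos (by omega)))
  obtain ⟨a, h4, h5, h6⟩ := hx.exists_notMem_ray hp (Subgroup.mem_subgroupOf.1 h1)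
    fun h => h2 (Subtype.ext h)
  exact ⟨n, a, h4, h5, z, Subgroup.mem_centralizer_iff.2 fun g hg =>
    congrArg Subtype.val (Subgroup.mem_center_iff.1 h3 ⟨g, hg⟩), h6⟩

theorem shift_mem_centralizer_window {t : X ≃* X} {c : ℤ} (ht : ∀ n, t (x n) = x (n + c))
    {n m : ℤ} {z : X} (hz : z ∈ Subgroup.centralizer (window x n m : Set X)) :
    t z ∈ Subgroup.centralizer (window x (n + c) (m + c) : Set X) := by
  rw [Subgroup.mem_centralizer_iff] at hz ⊢
  rw [← map_window ht]
  rintro _ ⟨g, hg, rfl⟩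
  have := congrArg t (hz g hg)
  rwa [map_mul, map_mul] at this

theorem isCentralIndex_zero_or_one (hp : p.Prime) (hx : IsZSystem p x) :
    IsCentralIndex x 0 ∨ IsCentralIndex x 1 := by
  by_contra! h
  simp only [IsCentralIndex, not_forall] at h
  obtain ⟨⟨R₀, h0⟩, R₁, h1⟩ := h
  set R := max R₀ R₁
  -- The extra `1` absorbs the parity of `a`, since only even shifts are available.
  obtain ⟨n, a, ha, ha', z, hz, h2⟩ := hx.exists_mem_centralizer_window hp (R + 1)
  obtain ⟨t, ht⟩ := hx.exists_even_shift (-(a / 2))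
  have hz' := Subgroup.centralizer_le
    (show (window x (-R) R : Set X) ⊆ _ from window_mono (by omega) (by omega))
    (shift_mem_centralizer_window ht hz)
  rw [← shift_mem_ray ht, ← shift_mem_ray (a := a + 1) ht] at h2
  rcases Int.emod_two_eq_zero_or_one a with h3 | h3
  · rw [show a + 2 * -(a / 2) = 0 by omega, show a + 1 + 2 * -(a / 2) = 0 + 1 by omega] at h2
    exact h0 ⟨t z, centralizer_window_anti (le_max_left _ _) hz', h2⟩
  · rw [show a + 2 * -(a / 2) = 1 by omega, show a + 1 + 2 * -(a / 2) = 1 + 1 by omega] at h2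
    exact h1 ⟨t z, centralizer_window_anti (le_max_right _ _) hz', h2⟩

theorem IsCentralIndex.shift (hx : IsZSystem p x) {a : ℤ} (h : IsCentralIndex x a) (s : ℤ) :
    IsCentralIndex x (a + 2 * s) := by
  obtain ⟨t, ht⟩ := hx.exists_even_shift s
  intro R
  obtain ⟨z, hz, h1⟩ := h (R + |2 * s|)
  have h2 := neg_abs_le (2 * s)
  have h3 := le_abs_self (2 * s)
  rw [← shift_mem_ray ht, ← shift_mem_ray (a := a + 1) ht] at h1
  exact ⟨t z, Subgroup.centralizer_le
    (show (window x (-R) R : Set X) ⊆ _ from window_mono (by omega) (by omega))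
    (shift_mem_centralizer_window ht hz), h1.1, by rw [add_right_comm]; exact h1.2⟩

theorem isCentralIndex_or_succ (hp : p.Prime) (hx : IsZSystem p x) (a : ℤ) :
    IsCentralIndex x (2 * a) ∨ IsCentralIndex x (2 * a + 1) := by
  rcases hx.isCentralIndex_zero_or_one hp with h | h
  · have := h.shift hx a
    rw [zero_add] at this
    exact Or.inl this
  · have := h.shift hx a
    rw [add_comm] at this
    exact Or.inr this

/-- The elements congruent modulo `ray x a` to elements centralizing arbitrarily large windows. -/
def hull (hx : IsZSystem p x) (a : ℤ) : Subgroup X where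
  carrier := {g | ∀ R : ℤ, ∃ z ∈ Subgroup.centralizer (window x (-R) R : Set X), z⁻¹ * g ∈ ray x a}
  one_mem' R := ⟨1, one_mem _, by simp⟩
  mul_mem' {g h} hg hh R := by
    obtain ⟨z, hz, hzg⟩ := hg R
    obtain ⟨R', hR, hR'⟩ := ((eventually_ge_atTop R).and (hx.eventually_commute (z⁻¹ * g))).exists
    obtain ⟨w, hw, hwh⟩ := hh R'
    refine ⟨z * w, mul_mem hz (centralizer_window_anti hR hw), ?_⟩
    have h1 : (z * w)⁻¹ * (g * h) = z⁻¹ * g * (w⁻¹ * h) := by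
      rw [mul_inv_rev, mul_assoc, ← mul_assoc z⁻¹, ← mul_assoc, (hR' w hw).inv_left.eq, mul_assoc]
    rw [h1]
    exact mul_mem hzg hwh
  inv_mem' {g} hg R := by
    obtain ⟨R', hR, hR'⟩ := ((eventually_ge_atTop R).and (hx.eventually_commute g)).exists
    obtain ⟨z, hz, hzg⟩ := hg R'
    refine ⟨z⁻¹, inv_mem (centralizer_window_anti hR hz), ?_⟩
    rw [(hR' z hz).inv_left.eq] at hzg
    simpa using inv_mem hzg

theorem ray_le_hull (hx : IsZSystem p x) (a : ℤ) : ray x a ≤ hx.hull a :=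
  fun g hg _ => ⟨1, one_mem _, by simpa using hg⟩

theorem hull_anti (hx : IsZSystem p x) {a b : ℤ} (h : a ≤ b) : hx.hull b ≤ hx.hull a :=
  fun _ hg R => (hg R).imp fun _ hz => ⟨hz.1, ray_anti h hz.2⟩

theorem shift_mem_hull_of_mem (hx : IsZSystem p x) {t : X ≃* X} {c : ℤ}
    (ht : ∀ n, t (x n) = x (n + c)) {a : ℤ} {g : X} (hg : g ∈ hx.hull a) :
    t g ∈ hx.hull (a + c) := by
  intro R
  obtain ⟨z, hz, h1⟩ := hg (R + |c|)
  have h2 := neg_abs_le c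
  have h3 := le_abs_self c
  rw [← shift_mem_ray ht, map_mul, map_inv] at h1
  exact ⟨t z, Subgroup.centralizer_le
    (show (window x (-R) R : Set X) ⊆ _ from window_mono (by omega) (by omega))
    (shift_mem_centralizer_window ht hz), h1⟩

theorem shift_mem_hull (hx : IsZSystem p x) {t : X ≃* X} {c : ℤ}
    (ht : ∀ n, t (x n) = x (n + c)) {a : ℤ} {g : X} : t g ∈ hx.hull (a + c) ↔ g ∈ hx.hull a := by
  refine ⟨fun h => ?_, hx.shift_mem_hull_of_mem ht⟩
  have ht' : ∀ n, t.symm (x n) = x (n + -c) := fun n => by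
    rw [MulEquiv.symm_apply_eq, ht, neg_add_cancel_right]
  have := hx.shift_mem_hull_of_mem ht' h
  rwa [add_neg_cancel_right, t.symm_apply_apply] at this

/-- The correcting factors can be chosen to commute with everything in sight, so both entries may be
replaced by elements of the ray. -/
theorem commutator_mem_ray_of_mem_hull (hp : p.Prime) (hx : IsZSystem p x) {a : ℤ} {g h : X}
    (hg : g ∈ hx.hull a) (hh : h ∈ hx.hull a) : ⁅g, h⁆ ∈ ray x (a + 1) := by
  obtain ⟨R, h1, h2⟩ := ((hx.eventually_commute g).and (hx.eventually_commute h)).exists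
  obtain ⟨z, hz, hzg⟩ := hg R
  obtain ⟨R', h3, h4⟩ :=
    ((hx.eventually_commute (z⁻¹ * g)).and (hx.eventually_commute h)).exists
  obtain ⟨w, hw, hwh⟩ := hh R'
  rw [← commutatorElement_mul_left_of_commute (h1 z hz).inv_left (h2 z hz).inv_left,
    ← commutatorElement_mul_right_of_commute (h3 w hw).inv_left (h4 w hw).inv_left]
  exact hx.commutator_mem_ray hp hzg hwh

theorem IsCentralIndex.hull_le (hp : p.Prime) (hx : IsZSystem p x) {a : ℤ}
    (h : IsCentralIndex x a) : hx.hull a ≤ hx.hull (a + 1) := by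
  intro g hg R
  obtain ⟨z, hz, hzg⟩ := hg R
  obtain ⟨c, hc, h1, h2⟩ := h R
  obtain ⟨n, hn⟩ := hx.exists_mul_zpow_mem_ray hp (inv_mem hzg) h1 h2
  refine ⟨z * c ^ n, mul_mem hz (zpow_mem hc n), ?_⟩
  have := inv_mem hn
  rwa [mul_inv_rev, inv_inv, ← mul_assoc, ← mul_inv_rev] at this

/-- Two correcting factors for `g` modulo `ray x a` differ by a centralizing element of that ray,
hence by an element of the next one. So a single good factor makes all of them good. -/
theorem mem_hull_succ (hx : IsZSystem p x) {a R : ℤ}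
    (hR : ∀ z ∈ Subgroup.centralizer (window x (-R) R : Set X), z ∈ ray x a → z ∈ ray x (a + 1))
    {g z : X} (hg : g ∈ hx.hull a) (hz : z ∈ Subgroup.centralizer (window x (-R) R : Set X))
    (hzg : z⁻¹ * g ∈ ray x (a + 1)) : g ∈ hx.hull (a + 1) := by
  intro R'
  obtain ⟨w, hw, hwg⟩ := hg (max R R')
  refine ⟨w, centralizer_window_anti (le_max_right _ _) hw, ?_⟩
  have h1 : z⁻¹ * w ∈ ray x (a + 1) := by
    refine hR _ (mul_mem (inv_mem hz) (centralizer_window_anti (le_max_left _ _) hw)) ?_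
    have := mul_mem (ray_anti (by omega) hzg) (inv_mem hwg)
    rwa [mul_inv_rev, inv_inv, mul_assoc, mul_inv_cancel_left] at this
  have := mul_mem (inv_mem h1) hzg
  rwa [mul_inv_rev, inv_inv, mul_assoc, mul_inv_cancel_left] at this

theorem exists_mul_zpow_mem_hull (hp : p.Prime) (hx : IsZSystem p x) {a : ℤ}
    (ha : ¬ IsCentralIndex x a) {g h : X} (hg : g ∈ hx.hull a) (hh : h ∈ hx.hull a)
    (hh' : h ∉ hx.hull (a + 1)) : ∃ n : ℤ, g * h ^ n ∈ hx.hull (a + 1) := by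
  obtain ⟨R₀, h0⟩ : ∃ R : ℤ, ∀ z ∈ Subgroup.centralizer (window x (-R) R : Set X),
      z ∈ ray x a → z ∈ ray x (a + 1) := by
    rw [IsCentralIndex] at ha
    push Not at ha
    exact ha
  obtain ⟨R, hR, h1, h2⟩ := ((eventually_ge_atTop R₀).and
    ((hx.eventually_commute g).and (hx.eventually_commute h))).exists
  obtain ⟨z, hz, hzg⟩ := hg R
  obtain ⟨w, hw, hwh⟩ := hh R
  have hz' := centralizer_window_anti hR hz
  have hw' := centralizer_window_anti hR hw
  obtain ⟨n, hn⟩ := hx.exists_mul_zpow_mem_ray hp hzg hwh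
    fun hc => hh' (hx.mem_hull_succ h0 hh hw' hc)
  refine ⟨n, hx.mem_hull_succ h0 (mul_mem hg (zpow_mem hh n)) (mul_mem (zpow_mem hw' n) hz') ?_⟩
  rw [(h2 w hw).inv_left.mul_zpow, inv_zpow, mul_assoc, ← mul_assoc g,
    ((h1 w hw).zpow_left n).inv_left.eq.symm] at hn
  rwa [mul_inv_rev, mul_assoc, ← mul_assoc _ g]

end Central

end IsZSystem

/-! ### Making a pair of filtrations separated. -/

section Quotient

open scoped commutatorElement

variable {G : Type*} [Group G] {t : G ≃* G} {E F : ℤ → Subgroup G}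

/-- A pair of filtrations which satisfies all the conditions of a bifiltration but separatedness
satisfies all of them modulo the intersection of its terms. -/
theorem IsBifiltration.of_forall {T : Subgroup G} [T.Normal]
    (hT : ∀ g, g ∈ T ↔ (∀ a, g ∈ E a) ∧ ∀ b, g ∈ F b)
    (lower_le : ∀ a, E (a + 1) ≤ E a)
    (le_upper : ∀ b, F (b - 1) ≤ F b)
    (map_lower : ∀ a g, t g ∈ E (a + 1) ↔ g ∈ E a)
    (map_upper : ∀ b g, t g ∈ F (b + 1) ↔ g ∈ F b)
    (lower_cyclic : ∀ a g h, g ∈ E a → h ∈ E a → h ∉ E (a + 1) → ∃ n : ℤ, g * h ^ n ∈ E (a + 1))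
    (upper_cyclic : ∀ b g h, g ∈ F b → h ∈ F b → h ∉ F (b - 1) → ∃ n : ℤ, g * h ^ n ∈ F (b - 1))
    (lower_comm : ∀ a g h, g ∈ E a → h ∈ E a → ⁅g, h⁆ ∈ E (a + 1))
    (upper_comm : ∀ b g h, g ∈ F b → h ∈ F b → ⁅g, h⁆ ∈ F (b - 1))
    (commute : ∀ a g h, g ∈ E a → g ∈ F a → h ∈ E a → h ∈ F a → Commute g h)
    (lower_exhaustive : ∀ g, ∃ a, g ∈ E a)
    (upper_exhaustive : ∀ g, ∃ b, g ∈ F b) :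
    ∃ s : (G ⧸ T) ≃* (G ⧸ T), IsBifiltration s (fun a => (E a).map (QuotientGroup.mk' T))
      fun b => (F b).map (QuotientGroup.mk' T) := by
  have hE : ∀ a g, QuotientGroup.mk' T g ∈ (E a).map (QuotientGroup.mk' T) ↔ g ∈ E a := fun a g => by
    rw [← Subgroup.mem_comap, Subgroup.comap_map_eq_self]
    rw [QuotientGroup.ker_mk']
    exact fun g hg => ((hT g).1 hg).1 a
  have hF : ∀ a g, QuotientGroup.mk' T g ∈ (F a).map (QuotientGroup.mk' T) ↔ g ∈ F a := fun a g => by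
    rw [← Subgroup.mem_comap, Subgroup.comap_map_eq_self]
    rw [QuotientGroup.ker_mk']
    exact fun g hg => ((hT g).1 hg).2 a
  have ht : T.map t.toMonoidHom = T := by
    have h1 : ∀ g, t g ∈ T ↔ g ∈ T := fun g => by
      rw [hT, hT]
      refine and_congr ⟨fun h a => (map_lower a g).1 (h _), fun h a => ?_⟩
        ⟨fun h a => (map_upper a g).1 (h _), fun h a => ?_⟩
      · simpa using (map_lower (a - 1) g).2 (h _)
      · simpa using (map_upper (a - 1) g).2 (h _)
    ext g
    constructor
    · rintro ⟨g, hg, rfl⟩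
      exact (h1 g).2 hg
    · exact fun hg => ⟨t.symm g, (h1 _).1 (by simpa using hg), t.apply_symm_apply g⟩
  refine ⟨QuotientGroup.congr T T t ht, ?_⟩
  constructor
  · exact fun a => Subgroup.map_mono (lower_le a)
  · exact fun b => Subgroup.map_mono (le_upper b)
  · rintro a ⟨g⟩
    exact (hE _ _).trans ((map_lower a g).trans (hE _ _).symm)
  · rintro a ⟨g⟩
    exact (hF _ _).trans ((map_upper a g).trans (hF _ _).symm)
  · rintro a ⟨g⟩ ⟨h⟩ hg hh hh'
    obtain ⟨n, hn⟩ := lower_cyclic a g h ((hE _ _).1 hg) ((hE _ _).1 hh)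
      fun hc => hh' ((hE _ _).2 hc)
    exact ⟨n, (hE _ (g * h ^ n)).2 hn⟩
  · rintro a ⟨g⟩ ⟨h⟩ hg hh hh'
    obtain ⟨n, hn⟩ := upper_cyclic a g h ((hF _ _).1 hg) ((hF _ _).1 hh)
      fun hc => hh' ((hF _ _).2 hc)
    exact ⟨n, (hF _ (g * h ^ n)).2 hn⟩
  · rintro a ⟨g⟩ ⟨h⟩ hg hh
    exact (hE _ ⁅g, h⁆).2 (lower_comm a g h ((hE _ _).1 hg) ((hE _ _).1 hh))
  · rintro a ⟨g⟩ ⟨h⟩ hg hh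
    exact (hF _ ⁅g, h⁆).2 (upper_comm a g h ((hF _ _).1 hg) ((hF _ _).1 hh))
  · rintro a ⟨g⟩ ⟨h⟩ h1 h2 h3 h4
    exact (commute a g h ((hE _ _).1 h1) ((hF _ _).1 h2) ((hE _ _).1 h3) ((hF _ _).1 h4)).map
      (QuotientGroup.mk' T)
  · rintro ⟨g⟩ h1 h2
    exact (QuotientGroup.eq_one_iff g).2
      ((hT g).2 ⟨fun a => (hE _ _).1 (h1 a), fun a => (hF _ _).1 (h2 a)⟩)
  · rintro ⟨g⟩
    exact (lower_exhaustive g).imp fun _ ha => (hE _ _).2 ha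
  · rintro ⟨g⟩
    exact (upper_exhaustive g).imp fun _ ha => (hF _ _).2 ha

end Quotient

/-! ### The two hull filtrations and the class bound. -/

namespace IsZSystem

section Class

open scoped commutatorElement

variable {X : Type*} [Group X] {p : ℕ} {x : ℤ → X}

/-- At a central index the hull does not drop, and one of `2 * a`, `2 * a + 1` is central; at most
one cyclic step remains. -/
theorem exists_mul_zpow_mem_hull_even (hp : p.Prime) (hx : IsZSystem p x) {a : ℤ} {g h : X}
    (hg : g ∈ hx.hull (2 * a)) (hh : h ∈ hx.hull (2 * a)) (hh' : h ∉ hx.hull (2 * (a + 1))) :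
    ∃ n : ℤ, g * h ^ n ∈ hx.hull (2 * (a + 1)) := by
  rw [show 2 * (a + 1) = 2 * a + 1 + 1 by ring] at *
  by_cases h0 : IsCentralIndex x (2 * a)
  · have hle := h0.hull_le hp hx
    by_cases h1 : IsCentralIndex x (2 * a + 1)
    · exact (hh' (h1.hull_le hp hx (hle hh))).elim
    · exact hx.exists_mul_zpow_mem_hull hp h1 (hle hg) (hle hh) hh'
  · have hle := ((hx.isCentralIndex_or_succ hp a).resolve_left h0).hull_le hp hx
    obtain ⟨n, hn⟩ := hx.exists_mul_zpow_mem_hull hp h0 hg hh fun hc => hh' (hle hc)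
    exact ⟨n, hle hn⟩

theorem commutator_mem_hull_even (hp : p.Prime) (hx : IsZSystem p x) {a : ℤ} {g h : X}
    (hg : g ∈ hx.hull (2 * a)) (hh : h ∈ hx.hull (2 * a)) : ⁅g, h⁆ ∈ hx.hull (2 * (a + 1)) := by
  rw [show 2 * (a + 1) = 2 * a + 1 + 1 by ring]
  rcases hx.isCentralIndex_or_succ hp a with h0 | h0
  · exact hx.ray_le_hull _ (hx.commutator_mem_ray_of_mem_hull hp (h0.hull_le hp hx hg)
      (h0.hull_le hp hx hh))
  · exact h0.hull_le hp hx (hx.ray_le_hull _ (hx.commutator_mem_ray_of_mem_hull hp hg hh))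

theorem exists_mem_hull_even (hx : IsZSystem p x) (g : X) : ∃ a : ℤ, g ∈ hx.hull (2 * a) := by
  obtain ⟨R, hR⟩ := hx.exists_mem_window g
  exact ⟨-|R|, hx.ray_le_hull _ (window_le_ray
    (by have := le_abs_self R; have := abs_nonneg R; omega) hR)⟩

theorem mem_center_of_forall_mem_hull (hp : p.Prime) (hx : IsZSystem p x) {g : X}
    (h1 : ∀ a, g ∈ hx.hull (2 * a)) (h2 : ∀ a, g ∈ hx.mirror.hull (2 * a)) :
    g ∈ Subgroup.center X := by
  have h : Set.range x ⊆ Subgroup.centralizer {g} := by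
    rintro _ ⟨q, rfl⟩
    rw [SetLike.mem_coe, Subgroup.mem_centralizer_singleton_iff]
    refine (commutatorElement_eq_one_iff_mul_comm.1 ?_).symm
    refine hx.eq_one_of_mem_rays hp (a := q + 1) (b := -q + 1) (by omega) ?_ ?_
    · refine hx.commutator_mem_ray_of_mem_hull hp (hx.hull_anti ?_ (h1 |q|)) (hx.ray_le_hull _
        (Subgroup.subset_closure ⟨q, Set.self_mem_Ici, rfl⟩))
      have := le_abs_self q
      have := abs_nonneg q
      omega
    · refine hx.mirror.commutator_mem_ray_of_mem_hull hp (hx.mirror.hull_anti ?_ (h2 |q|))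
        (hx.mirror.ray_le_hull _ (Subgroup.subset_closure ⟨-q, Set.self_mem_Ici, by simp⟩))
      have := neg_abs_le q
      have := abs_nonneg q
      omega
  have h3 := (Subgroup.closure_le _).2 h
  rw [hx.closure_range, top_le_iff, Subgroup.centralizer_eq_top_iff_subset] at h3
  exact h3 rfl

theorem commutator_le_center (hp : p.Prime) (hx : IsZSystem p x) :
    commutator X ≤ Subgroup.center X := by
  obtain ⟨t, ht⟩ := hx.exists_even_shift 1
  have ht' : ∀ n, t (x (-n)) = x (-(n + -2)) := fun n => by rw [ht]; congr 1; ring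
  set T : Subgroup X := (⨅ a, hx.hull (2 * a)) ⊓ ⨅ b, hx.mirror.hull (2 * -b) with hTdef
  have hT : ∀ g, g ∈ T ↔ (∀ a, g ∈ hx.hull (2 * a)) ∧ ∀ b, g ∈ hx.mirror.hull (2 * -b) :=
    fun g => by rw [hTdef, Subgroup.mem_inf, Subgroup.mem_iInf, Subgroup.mem_iInf]
  have hTc : T ≤ Subgroup.center X := fun g hg => hx.mem_center_of_forall_mem_hull hp
    ((hT g).1 hg).1 fun a => by simpa using ((hT g).1 hg).2 (-a)
  have : T.Normal := ⟨fun n hn g => by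
    rwa [Subgroup.mem_center_iff.1 (hTc hn) g, mul_inv_cancel_right]⟩
  obtain ⟨s, hs⟩ := IsBifiltration.of_forall (t := t) hT
    (fun a => hx.hull_anti (by omega))
    (fun b => hx.mirror.hull_anti (by omega))
    (fun a g => by rw [show 2 * (a + 1) = 2 * a + 2 * 1 by ring, hx.shift_mem_hull ht])
    (fun b g => by rw [show 2 * -(b + 1) = 2 * -b + -2 by ring, hx.mirror.shift_mem_hull ht'])
    (fun a g h => hx.exists_mul_zpow_mem_hull_even hp)
    (fun b g h => by
      rw [show -(b - 1) = -b + 1 by ring]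
      exact hx.mirror.exists_mul_zpow_mem_hull_even hp)
    (fun a g h => hx.commutator_mem_hull_even hp)
    (fun b g h => by
      rw [show -(b - 1) = -b + 1 by ring]
      exact hx.mirror.commutator_mem_hull_even hp)
    -- The commutator lives on indices at least `2 * a + 1` and also on indices at most `2 * a - 1`.
    (fun a g h h1 h2 h3 h4 => commutatorElement_eq_one_iff_commute.1 <|
      hx.eq_one_of_mem_rays hp (a := 2 * a + 1) (b := 2 * -a + 1) (by omega)
        (hx.commutator_mem_ray_of_mem_hull hp h1 h3)
        (hx.mirror.commutator_mem_ray_of_mem_hull hp h2 h4))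
    hx.exists_mem_hull_even
    (fun g => (hx.mirror.exists_mem_hull_even g).elim fun a ha => ⟨-a, by rwa [neg_neg]⟩)
  refine le_trans ?_ hTc
  rw [commutator_def, Subgroup.commutator_le]
  intro g _ h _
  rw [← QuotientGroup.eq_one_iff, ← QuotientGroup.mk'_apply, map_commutatorElement]
  exact commutatorElement_eq_one_iff_commute.2 (hs.commute_all _ _)

end Class

end IsZSystem

theorem mainTheorem2 {X : Type*} [Group X] (p : ℕ) (hp : p.Prime) (x : ℤ → X)
    (hx : IsZSystem p x) :
    Group.IsNilpotent X ∧ Group.nilpotencyClass X ≤ 2 ∧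
      ⁅⁅(⊤ : Subgroup X), (⊤ : Subgroup X)⁆, (⊤ : Subgroup X)⁆ = ⊥ := by
  have h : ⁅⁅(⊤ : Subgroup X), (⊤ : Subgroup X)⁆, (⊤ : Subgroup X)⁆ = ⊥ := by
    rw [Subgroup.commutator_eq_bot_iff_le_centralizer, Subgroup.coe_top, Subgroup.centralizer_univ]
    exact hx.commutator_le_center hp
  have h2 : Subgroup.lowerCentralSeries (⊤ : Subgroup X) 2 = ⊥ := h
  have hn : Group.IsNilpotent X := Subgroup.nilpotent_iff_lowerCentralSeries.2 ⟨2, h2⟩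
  exact ⟨hn, Subgroup.lowerCentralSeries_eq_bot_iff_nilpotencyClass_le.1 h2, h⟩
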